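/- Let $N \ge 0$ be an integer and let $\mu$ be a partition of $N+1$ whose number of parts $p$ satisfies $p \equiv N \pmod 2$. Then $$\frac{N+1}{2}\sum_{\substack{i>0\\ i+1 \text{ is a part of } \mu}} i\, m_i\big(\mu^{\downarrow(i+1)}\big)\, B\big(\mu^{\downarrow(i+1)}\big) \;=\; A(\mu) \;=\; \frac{(N+1)!}{z_\mu}.$$ Here the type of a permutation is the partition formed by the lengths of all its cycles, fixed points included. $A(\mu)$ is the number of permutations of $\{1,\dots,N+1\}$ of type $\mu$. For a partition $\lambda$ of $N$, $B(\lambda)$ is the number of permutations $\beta$ of $\{1,\dots,N\}$ of type $\lambda$ such that $(1\ 2\ \dots\ N)\,\beta^{-1}$ is a long cycle, i.e. has exactly one cycle, of length $N$ (for $N=1$ the identity is a long cycle). For an integer $i>0$ such that $i+1$ is a part of $\mu$, $\mu^{\downarrow(i+1)}$ is the partition of $N$ obtained from $\mu$ by erasing one part $i+1$ and adding one part $i$; each such value of $i$ contributes one term to the sum. Finally, $m_i(\lambda)$ is the number of parts of $\lambda$ equal to $i$, and $z_\mu=\prod_{i\ge 1} i^{m_i(\mu)}\, m_i(\mu)!$.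 -/

import Mathlib

namespace CycleFactor

/-- The permutation `σ` of `[n]` has type `lam`: the multiset of the lengths of all its cycles
(fixed points are cycles of length one) is the multiset of parts of `lam`. -/
def HasType {n : ℕ} (σ : Equiv.Perm (Fin n)) (lam : n.Partition) : Prop :=
  σ.partition.parts = lam.parts

/-- `σ` is a long cycle of `[n]`: all of `[n]` forms one single cycle of `σ`.
(For `n = 1` this is the identity, unlike with `Equiv.Perm.IsCycle`.) -/
def IsLongCycle {n : ℕ} (σ : Equiv.Perm (Fin n)) : Prop :=
  σ.IsCycleOn Set.univ

/-- `A(lam)`: the number of permutations of `[n]` of type `lam`. -/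
noncomputable def numA {n : ℕ} (lam : n.Partition) : ℕ :=
  Nat.card {β : Equiv.Perm (Fin n) // HasType β lam}

/-- `B(lam)`: the number of permutations `β` of `[n]` of type `lam` such that
`(1 2 … n) β⁻¹` is a long cycle. The cycle `(1 2 … n)` is `finRotate n`. -/
noncomputable def numB {n : ℕ} (lam : n.Partition) : ℕ :=
  Nat.card {β : Equiv.Perm (Fin n) // HasType β lam ∧ IsLongCycle (finRotate n * β⁻¹)}

/-- The number `m_i(lam)` of parts of `lam` that are equal to `i`. -/
def mult {n : ℕ} (lam : n.Partition) (i : ℕ) : ℕ :=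
  lam.parts.count i

/-- `z_lam = ∏ i, i ^ m_i(lam) * m_i(lam)!`; only the `i` that are parts of `lam` contribute
a factor different from `1`. -/
def zee {n : ℕ} (lam : n.Partition) : ℕ :=
  ∏ i ∈ lam.parts.toFinset, i ^ mult lam i * (mult lam i).factorial

/-- The partition obtained from `mu` by erasing one part `i + 1` and adding one part `i`,
where `i > 0` and `mu` has at least one part `i + 1`. -/
def down {N : ℕ} (mu : (N + 1).Partition) (i : ℕ) (h : 0 < i ∧ i + 1 ∈ mu.parts) :
    N.Partition where
  parts := i ::ₘ mu.parts.erase (i + 1)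
  parts_pos := by
    intro j hj
    rcases Multiset.mem_cons.1 hj with rfl | hj
    · exact h.1
    · exact mu.parts_pos (Multiset.mem_of_mem_erase hj)
  parts_sum := by
    have h1 := mu.parts_sum
    rw [← Multiset.cons_erase h.2, Multiset.sum_cons] at h1
    rw [Multiset.sum_cons]
    omega

end CycleFactor

/-!
The identity compares two ways of building permutations of type `mu`, writing `n = N + 1`.

Let `d` be the inverse of the cycle `finRotate N` on `Fin N`, extended to `Fin (N + 1)` by a fixed
point `0`. Inserting `0` before a point `p` into the cycles of a permutation `β` of `Fin N`
(`decomposeFin.symm (p.succ, β)`) lengthens the cycle of `p` by one, and `π ↦ π * d` turns the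
result of inserting into `β` into the result of inserting into `β * (finRotate N)⁻¹`. A permutation
of type `down mu i` has `i * mult (down mu i) i` points in cycles of length `i`, so the sum on the
left of the identity counts the `π` of type `mu` for which `π * d` is a full cycle
(`card_hasType_and_isCycleOn`). The claim is thus that this happens for exactly `2 / n` of all `π`
of type `mu`, the parity condition saying that these `π` are odd.

By conjugation one may instead fix an odd `π` and let `D` run through all pointed cycles, i.e.
the conjugates of `d` with their fixed point (`card_mul_card_mul_isCycleOn`). A full
cycle `σ` is detected by a principal minor of `1 - σ`, which expands into an alternating sum, over
the sets `T` avoiding a chosen point, of the sign of `σ` restricted to `T` (`sum_restrSign_eq`).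
Summed over `σ = π * D`, all terms with `2 ≤ #T ≤ n - 2` vanish (`sum_restrSign_pointedCycles`):
conjugating `D` by a transposition changes the sign unless `T` and `π⁻¹ T` coincide or differ by
one exchange. If they coincide, each term is zero, as no `D` preserves `T`; if they differ by one
exchange, moving the fixed point of `D` between `T` and its complement is a sign-reversing bijection
(`shiftPoint_spec`). In representation-theoretic terms, the class sum acts as zero on the
hook representations other than the trivial and the sign one. The remaining terms are
those with `T` empty, a singleton, or of size `n - 1`. If `P` is the number of pointed cycles, they
contribute `P`, `-(n - 1) * (P / n)` and, because `π` is odd, `+P / n`; together `2 * P / n`. This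
is for `n ≥ 3`; on two points, `D = 1` and `π * D` is always a full cycle.
-/

namespace CycleFactor

open Equiv Equiv.Perm Finset

/-! ### Signs of restrictions and the detection of full cycles -/

section RestrictedSign

variable {α : Type*} [Fintype α]

/-- A set closed under a permutation of a finite type contains the cycles of its elements. -/
theorem mem_of_sameCycle {σ : Perm α} {U : Set α} (hU : ∀ u ∈ U, σ u ∈ U) {x y : α}
    (h : σ.SameCycle x y) (hx : x ∈ U) : y ∈ U := by
  obtain ⟨i, rfl⟩ := h.exists_nat_pow_eq
  clear h
  induction i with
  | zero => simpa
  | succ i ih => rw [pow_succ', mul_apply]; exact hU _ ih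

theorem isCycleOn_univ_iff {α : Type*} {σ : Perm α} :
    σ.IsCycleOn Set.univ ↔ ∀ x y, σ.SameCycle x y := by
  simp [IsCycleOn, Set.bijOn_univ, σ.bijective]

variable [DecidableEq α]

/-- The signed indicator of bijectivity of a map `h : α → α`: the determinant of the matrix whose
row `j` is the basis vector `h j`. -/
noncomputable def mapDet (h : α → α) : ℤ :=
  (Matrix.of fun j => (Pi.single (h j) 1 : α → ℤ)).det

theorem mapDet_comp (h k : α → α) : mapDet (h ∘ k) = mapDet h * mapDet k := by
  rw [mapDet, mapDet, mapDet, mul_comm, ← Matrix.det_mul]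
  congr 1
  ext j i
  rw [Matrix.mul_apply, Finset.sum_eq_single (k j)]
  · simp
  · intro b _ hb
    simp [hb]
  · simp

theorem mapDet_perm (σ : Perm α) : mapDet σ = (sign σ : ℤ) := by
  rw [mapDet, ← Int.cast_id (n := ((sign σ : ℤˣ) : ℤ)), ← Matrix.det_permutation]
  congr 1
  ext j i
  simp [Pi.single_apply, PEquiv.toMatrix_apply, eq_comm]

theorem mapDet_id : mapDet (id : α → α) = 1 := by
  simpa using mapDet_perm (1 : Perm α)

theorem mapDet_eq_zero {h : α → α} {i j : α} (hij : i ≠ j) (e : h i = h j) : mapDet h = 0 :=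
  Matrix.det_zero_of_row_eq hij (by ext k; simp [e])

/-- The sign of the restriction of `σ` to `T`, and `0` if `σ` does not map `T` into itself. It is
encoded as the determinant of the map that agrees with `σ` on `T` and is the identity off `T`, so
that no subtypes occur. -/
noncomputable def restrSign (σ : Perm α) (T : Finset α) : ℤ :=
  mapDet (T.piecewise σ id)

theorem restrSign_congr {σ τ : Perm α} {T : Finset α} (h : ∀ j ∈ T, σ j = τ j) :
    restrSign σ T = restrSign τ T := by
  rw [restrSign, restrSign]
  congr 1
  ext j
  by_cases hj : j ∈ T <;> simp [hj, h]

theorem restrSign_eq_zero {σ : Perm α} {T : Finset α} {j : α} (hj : j ∈ T) (h : σ j ∉ T) :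
    restrSign σ T = 0 :=
  mapDet_eq_zero (i := j) (j := σ j) (fun e => h (e ▸ hj)) (by simp [hj, h])

theorem restrSign_mul_of_right {ρ σ : Perm α} {T : Finset α} (h : ∀ j ∈ T, σ j ∈ T) :
    restrSign (ρ * σ) T = restrSign ρ T * restrSign σ T := by
  rw [restrSign, restrSign, restrSign, ← mapDet_comp]
  congr 1
  ext j
  by_cases hj : j ∈ T
  · simp [hj, h j hj]
  · simp [hj]

theorem restrSign_mul_of_left {ρ σ : Perm α} {T : Finset α} (h : ∀ j, ρ j ∈ T ↔ j ∈ T) :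
    restrSign (ρ * σ) T = restrSign ρ T * restrSign σ T := by
  by_cases hσ : ∀ j ∈ T, σ j ∈ T
  · exact restrSign_mul_of_right hσ
  · push Not at hσ
    obtain ⟨j, hj, hn⟩ := hσ
    rw [restrSign_eq_zero hj hn, restrSign_eq_zero hj (by simpa [h] using hn), mul_zero]

theorem restrSign_swap {a b : α} {T : Finset α} (ha : a ∈ T) (hb : b ∈ T) (hab : a ≠ b) :
    restrSign (swap a b) T = -1 := by
  have : T.piecewise (swap a b) id = swap a b := by
    ext j
    by_cases hj : j ∈ T
    · simp [hj]
    · simp only [hj, not_false_eq_true, Finset.piecewise_eq_of_notMem, id]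
      rw [swap_apply_of_ne_of_ne] <;> rintro rfl <;> contradiction
  rw [restrSign, this, mapDet_perm, sign_swap hab]
  rfl

theorem swap_mem_iff {α : Type*} [DecidableEq α] {a b : α} {T : Finset α}
    (h : a ∈ T ↔ b ∈ T) (j : α) :
    swap a b j ∈ T ↔ j ∈ T := by
  rw [swap_apply_def]
  split_ifs with h1 h2 <;> simp_all

theorem restrSign_empty (σ : Perm α) : restrSign σ ∅ = 1 := by
  simp [restrSign, mapDet_id]

theorem restrSign_singleton (σ : Perm α) (a : α) :
    restrSign σ {a} = if σ a = a then 1 else 0 := by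
  split_ifs with h
  · rw [restrSign_congr (τ := 1) (by simpa using h), restrSign, ← mapDet_id (α := α)]
    congr 1
    ext j
    simp [Finset.piecewise]
  · exact restrSign_eq_zero (mem_singleton_self a) (by simpa using h)

theorem restrSign_compl_singleton (σ : Perm α) (a : α) :
    restrSign σ {a}ᶜ = if σ a = a then (sign σ : ℤ) else 0 := by
  split_ifs with h
  · rw [restrSign, ← mapDet_perm]
    congr 1
    ext j
    by_cases hj : j = a <;> simp [hj, h]
  · refine restrSign_eq_zero (j := σ.symm a) ?_ (by simp)
    simpa [Equiv.symm_apply_eq] using Ne.symm h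

/-- Detection of full cycles by restricted signs: the sum is the principal minor of `1 - σ`
omitting `x`. It vanishes if a cycle of `σ` avoids `x`, since the rows of the minor then kill the
indicator of that cycle; and for a full cycle only `T = ∅` is invariant. -/
theorem sum_restrSign_eq (σ : Perm α) (x : α) [Decidable (σ.IsCycleOn Set.univ)] :
    ∑ T ∈ ({x}ᶜ : Finset α).powerset, (-1) ^ #T * restrSign σ T =
      if σ.IsCycleOn Set.univ then 1 else 0 := by
  split_ifs with h
  · rw [isCycleOn_univ_iff] at h
    rw [Finset.sum_eq_single_of_mem ∅ (by simp)]
    · simp [restrSign_empty]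
    · intro T hT hne
      obtain ⟨t, ht⟩ := Finset.nonempty_iff_ne_empty.2 hne
      have hx : x ∉ T := fun hx => by simpa using Finset.mem_powerset.1 hT hx
      by_cases hc : ∀ u ∈ (T : Set α), σ u ∈ (T : Set α)
      · exact absurd (mem_of_sameCycle hc (h t x) ht) hx
      · push Not at hc
        obtain ⟨u, hu, hn⟩ := hc
        rw [restrSign_eq_zero hu hn, mul_zero]
  · let m : α → α → ℤ := fun j => -Pi.single (σ j) 1
    let m' : α → α → ℤ := fun j => Pi.single j 1
    -- expand the minor, whose rows are `m j + m' j`, multilinearly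
    have key (T : Finset α) : (-1) ^ #T * restrSign σ T =
        Matrix.detRowAlternating (R := ℤ) (T.piecewise m m') := by
      have : T.piecewise m m' = T.piecewise (fun j => (-1 : ℤ) •
          (T.piecewise (fun j => Pi.single (σ j) 1) m' : α → α → ℤ) j)
            (T.piecewise (fun j => Pi.single (σ j) 1) m') := by
        ext j i
        by_cases hj : j ∈ T <;> simp [hj, m, m']
      rw [this]
      have h2 := (Matrix.detRowAlternating (R := ℤ) (n := α)).toMultilinearMap.map_piecewise_smul
        (fun _ => (-1 : ℤ)) (T.piecewise (fun j => Pi.single (σ j) 1) m') T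
      simp only [Finset.prod_const] at h2
      refine Eq.trans ?_ h2.symm
      rw [smul_eq_mul, restrSign, mapDet]
      congr 2
      ext j i
      by_cases hj : j ∈ T <;> simp [hj, m']
    rw [Finset.sum_congr rfl fun T _ => key T]
    have h3 := (Matrix.detRowAlternating (R := ℤ) (n := α)).toMultilinearMap.map_piecewise_add
      m m' ({x}ᶜ : Finset α)
    refine Eq.trans h3.symm ?_
    refine Matrix.exists_mulVec_eq_zero_iff.1 ?_
    rw [isCycleOn_univ_iff] at h
    push Not at h
    obtain ⟨y, hy⟩ : ∃ y, ¬ σ.SameCycle x y := by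
      by_contra! hc
      obtain ⟨a, b, hab⟩ := h
      exact hab ((hc a).symm.trans (hc b))
    classical
    refine ⟨fun j => if σ.SameCycle y j then 1 else 0, fun h0 => ?_, ?_⟩
    · simpa [SameCycle.refl] using congrFun h0 y
    · ext j
      change dotProduct (({x}ᶜ : Finset α).piecewise (m + m') m' j) _ = 0
      by_cases hj : j = x
      · simp [hj, m', sameCycle_comm (x := y), hy]
      · simp [hj, m, m', add_dotProduct, sameCycle_apply_right]

end RestrictedSign

/-! ### Pointed cycles -/

section PointedCycles

variable {α : Type*}

theorem isCycleOn_compl_singleton_iff {D : Perm α} {v : α} :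
    D.IsCycleOn {v}ᶜ ↔ D v = v ∧ ∀ x, x ≠ v → ∀ y, y ≠ v → D.SameCycle x y := by
  refine ⟨fun h => ⟨?_, fun x hx y hy => h.2 hx hy⟩, fun h => ⟨?_, fun x hx y hy => h.2 x hx y hy⟩⟩
  · by_contra hv
    exact (h.apply_mem_iff (x := v)).1 hv rfl
  · refine ⟨fun x hx hxv => hx (D.injective (hxv.trans h.1.symm)), D.injective.injOn, fun y hy => ?_⟩
    refine ⟨D.symm y, fun e => hy ?_, by simp⟩
    have e : D.symm y = v := e
    rw [Equiv.symm_apply_eq] at e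
    exact e.trans h.1

theorem IsCycleOn.conj_compl_singleton {D : Perm α} {v : α} (h : D.IsCycleOn {v}ᶜ) (g : Perm α) :
    (g * D * g⁻¹).IsCycleOn {g v}ᶜ := by
  have := h.conj (g := g)
  rwa [Set.image_compl_eq g.bijective, Set.image_singleton] at this

variable [Fintype α] [DecidableEq α]

/-- In the cyclic order of the cycle `D`, put its fixed point `v` right after `x` and take out the
successor `D y` of `y`: the result is again a cycle on all points but one. -/
theorem IsCycleOn.shift {D : Perm α} {v x y : α} (h : D.IsCycleOn {v}ᶜ) (hxy : x ≠ y)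
    (hx : x ≠ v) (hy : y ≠ v) (hyx : D y ≠ x) :
    (D * swap x v * swap y (D y)).IsCycleOn {D y}ᶜ := by
  obtain ⟨hv, hc⟩ := isCycleOn_compl_singleton_iff.1 h
  have hbv : D y ≠ v := fun e => hy (D.injective (e.trans hv.symm))
  have hby : D y ≠ y := fun e => hx (by
    have h1 := (hc y hy x hx).eq_of_left e
    exact absurd h1.symm hxy)
  set E := D * swap x v * swap y (D y) with hE
  have Ex : E x = v := by
    rw [hE, mul_apply, swap_apply_of_ne_of_ne hxy hyx.symm, mul_apply, swap_apply_left, hv]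
  have Ev : E v = D x := by
    rw [hE, mul_apply, swap_apply_of_ne_of_ne hy.symm hbv.symm, mul_apply, swap_apply_right]
  have Ey : E y = D (D y) := by
    rw [hE, mul_apply, swap_apply_left, mul_apply, swap_apply_of_ne_of_ne hyx hbv]
  have Eb : E (D y) = D y := by
    rw [hE, mul_apply, swap_apply_right, mul_apply, swap_apply_of_ne_of_ne hxy.symm hy]
  have Eu (u : α) (h1 : u ≠ x) (h2 : u ≠ v) (h3 : u ≠ y) (h4 : u ≠ D y) : E u = D u := by
    rw [hE, mul_apply, swap_apply_of_ne_of_ne h3 h4, mul_apply, swap_apply_of_ne_of_ne h1 h2]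
  have Dne {u : α} (hu : u ≠ v) : D u ≠ v := fun e => hu (D.injective (e.trans hv.symm))
  refine isCycleOn_compl_singleton_iff.2 ⟨Eb, fun s hs => ?_⟩
  -- `U` is the `E`-cycle of `s`; adapting it at `v` and `D y` gives a `D`-closed set.
  let U : Set α := {w | E.SameCycle s w}
  have hU {u : α} (hu : u ∈ U) : E u ∈ U := sameCycle_apply_right.2 hu
  have hbU : D y ∉ U := fun hb => hs (SameCycle.eq_of_right hb Eb)
  let W : Set α := {w | (w ∈ U ∧ w ≠ v) ∨ (w = D y ∧ y ∈ U)}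
  have hW : ∀ u ∈ W, D u ∈ W := by
    rintro u (⟨hu, huv⟩ | ⟨rfl, hyU⟩)
    · by_cases h1 : u = x
      · subst h1
        refine Or.inl ⟨?_, Dne huv⟩
        rw [← Ev]
        apply hU
        rw [← Ex]
        exact hU hu
      by_cases h3 : u = y
      · subst h3
        exact Or.inr ⟨rfl, hu⟩
      have h4 : u ≠ D y := fun e => hbU (e ▸ hu)
      exact Or.inl ⟨Eu u h1 huv h3 h4 ▸ hU hu, Dne huv⟩
    · exact Or.inl ⟨Ey ▸ hU hyU, Dne hbv⟩
  obtain ⟨w, hw, hwv⟩ : ∃ w ∈ W, w ≠ v := by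
    by_cases hsv : s = v
    · refine ⟨D x, Or.inl ⟨?_, Dne hx⟩, Dne hx⟩
      rw [← Ev, ← hsv]
      exact hU (SameCycle.refl _ _)
    · exact ⟨s, Or.inl ⟨SameCycle.refl _ _, hsv⟩, hsv⟩
  have all (t : α) (ht : t ≠ v) : t ∈ W := mem_of_sameCycle hW (hc w hwv t ht) hw
  have main (t : α) (ht : t ≠ v) (htb : t ≠ D y) : t ∈ U := by
    rcases all t ht with h | h
    · exact h.1
    · exact absurd h.1 htb
  intro t ht
  by_cases htv : t = v
  · rw [htv, ← Ex]
    exact hU (main x hx hyx.symm)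
  · exact main t htv ht

variable (α) in
open Classical in
/-- The pairs `(v, D)` of a point `v` and a permutation `D` that fixes `v` and permutes all other
points in one cycle. -/
noncomputable def pointedCycles : Finset (α × Perm α) :=
  univ.filter fun p => p.2.IsCycleOn {p.1}ᶜ

theorem mem_pointedCycles {p : α × Perm α} :
    p ∈ pointedCycles α ↔ p.2.IsCycleOn {p.1}ᶜ := by
  simp [pointedCycles]

theorem sum_pointedCycles_conj {M : Type*} [AddCommMonoid M] (g : Perm α) (f : Perm α → M) :
    ∑ p ∈ pointedCycles α, f (g * p.2 * g⁻¹) = ∑ p ∈ pointedCycles α, f p.2 := by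
  refine Finset.sum_equiv (Equiv.prodCongr g (MulAut.conj g).toEquiv) (fun p => ?_) (fun p _ => ?_)
  · rw [mem_pointedCycles, mem_pointedCycles]
    refine ⟨fun h => IsCycleOn.conj_compl_singleton h g, fun h => ?_⟩
    have := IsCycleOn.conj_compl_singleton h g⁻¹
    simpa [mul_assoc] using this
  · simp

theorem card_pointedCycles_conj (g : Perm α) (a b : α) :
    #{p ∈ pointedCycles α | p.2 (g a) = g b} = #{p ∈ pointedCycles α | p.2 a = b} := by
  rw [card_filter, card_filter]
  refine (sum_pointedCycles_conj g fun D => if D (g a) = g b then 1 else 0).symm.trans ?_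
  simp

/-- On at least three points, the pointed cycles with `D a = b` make up the same proportion
`1 / card α` of all, whether or not `a = b`. -/
theorem card_mul_card_pointedCycles (h3 : 3 ≤ Fintype.card α) (a b : α) :
    Fintype.card α * #{p ∈ pointedCycles α | p.2 a = b} = #(pointedCycles α) := by
  have fixed (c d : α) :
      #{p ∈ pointedCycles α | p.2 c = c} = #{p ∈ pointedCycles α | p.2 d = d} := by
    simpa using card_pointedCycles_conj (swap c d) d d
  -- the fixed point of `D` is unique
  have uniq (p) (hp : p ∈ pointedCycles α) (c : α) : p.2 c = c ↔ p.1 = c := by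
    obtain ⟨hv, hc⟩ := isCycleOn_compl_singleton_iff.1 (mem_pointedCycles.1 hp)
    refine ⟨fun h => ?_, fun h => h ▸ hv⟩
    by_contra hne
    obtain ⟨d, hd⟩ : ∃ d, d ∉ ({p.1, c} : Finset α) := by
      by_contra! hall
      have := Finset.card_le_card (fun d (_ : d ∈ univ) => hall d)
      have := this.trans card_le_two
      rw [card_univ] at this
      omega
    simp only [mem_insert, mem_singleton, not_or] at hd
    exact hd.2 ((hc c (Ne.symm hne) d hd.1).eq_of_left h).symm
  have sum_fixed : ∑ c, #{p ∈ pointedCycles α | p.2 c = c} = #(pointedCycles α) := by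
    simp_rw [card_filter]
    rw [sum_comm, card_eq_sum_ones]
    refine sum_congr rfl fun p hp => ?_
    simp [uniq p hp]
  have h1 (c : α) : Fintype.card α * #{p ∈ pointedCycles α | p.2 c = c} = #(pointedCycles α) := by
    rw [← sum_fixed, sum_congr rfl fun d _ => fixed d c]
    simp
  by_cases hab : a = b
  · exact hab ▸ h1 a
  have moved (c : α) (hc : c ∈ ({a}ᶜ : Finset α)) :
      #{p ∈ pointedCycles α | p.2 a = c} = #{p ∈ pointedCycles α | p.2 a = b} := by
    have := card_pointedCycles_conj (swap b c) a b
    rwa [swap_apply_left, swap_apply_of_ne_of_ne hab] at this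
    rintro rfl
    simp at hc
  have tot : ∑ c, #{p ∈ pointedCycles α | p.2 a = c} = #(pointedCycles α) := by
    simp_rw [card_filter]
    rw [sum_comm, card_eq_sum_ones]
    simp
  rw [Fintype.sum_eq_add_sum_compl a, sum_congr rfl moved, sum_const, card_compl, card_singleton,
    smul_eq_mul] at tot
  have ha := h1 a
  obtain ⟨m, hm⟩ : ∃ m, Fintype.card α = m + 2 := ⟨Fintype.card α - 2, by omega⟩
  rw [hm] at ha tot ⊢
  rw [show m + 2 - 1 = m + 1 by omega] at tot
  have : #{p ∈ pointedCycles α | p.2 a = a} = #{p ∈ pointedCycles α | p.2 a = b} := by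
    have : (m + 1) * #{p ∈ pointedCycles α | p.2 a = a} =
      (m + 1) * #{p ∈ pointedCycles α | p.2 a = b} := by linarith
    exact Nat.eq_of_mul_eq_mul_left (by omega) this
  rw [← this, ha]

theorem isCycle_of_mem_pointedCycles (h3 : 3 ≤ Fintype.card α) {p : α × Perm α}
    (hp : p ∈ pointedCycles α) : p.2.IsCycle ∧ #p.2.support + 1 = Fintype.card α := by
  have hp' := mem_pointedCycles.1 hp
  obtain ⟨hv, hc⟩ := isCycleOn_compl_singleton_iff.1 hp'
  have hcard : #({p.1}ᶜ : Finset α) + 1 = Fintype.card α := by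
    rw [card_compl, card_singleton]; omega
  have hnt : ({p.1}ᶜ : Set α).Nontrivial := by
    have : 1 < #({p.1}ᶜ : Finset α) := by omega
    simpa [Finset.Nontrivial] using Finset.one_lt_card_iff_nontrivial.1 this
  have hs : p.2.support = {p.1}ᶜ := by
    ext u
    rw [mem_support, mem_compl, mem_singleton]
    exact ⟨fun h e => h (by rw [e, hv]), fun h => hp'.apply_ne hnt h⟩
  have hcyc : p.2.IsCycle := by
    obtain ⟨u, hu⟩ := hnt.nonempty
    refine ⟨u, hp'.apply_ne hnt hu, fun y hy => hc u hu y fun e => hy (by rw [e, hv])⟩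
  exact ⟨hcyc, by rw [hs, hcard]⟩

theorem sign_of_mem_pointedCycles (h3 : 3 ≤ Fintype.card α) {p : α × Perm α}
    (hp : p ∈ pointedCycles α) : (sign p.2 : ℤ) = (-1) ^ Fintype.card α := by
  obtain ⟨hcyc, hcard⟩ := isCycle_of_mem_pointedCycles h3 hp
  rw [hcyc.sign, ← hcard, pow_succ]
  simp

end PointedCycles

/-! ### Cancellation in the sum over pointed cycles -/

section Cancellation

variable {α : Type*} [Fintype α] [DecidableEq α]

/-- Exchange the fixed point `v` of the pointed cycle `(v, D)`, inserted after `x`, for the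
successor of `y`. -/
def shiftPoint (x y : α) (p : α × Perm α) : α × Perm α :=
  (p.2 y, p.2 * swap x p.1 * swap y (p.2 y))

/-- If `swap x y * D` preserves `T`, which separates `x` from `y` and whose complement is not just
`{y}`, then `shiftPoint x y` moves the fixed point out of `T`, keeps the invariance of `T`, and is
undone by `shiftPoint y x`. -/
theorem shiftPoint_spec {T : Finset α} {x y : α} (hx : x ∈ T) (hy : y ∉ T) (hT : 2 ≤ #Tᶜ)
    {p : α × Perm α} (hp : p ∈ pointedCycles α) (hv : p.1 ∈ T)
    (hs : ∀ j, swap x y (p.2 j) ∈ T ↔ j ∈ T) :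
    shiftPoint x y p ∈ pointedCycles α ∧ (shiftPoint x y p).1 ∉ T ∧
      (∀ j, swap x y ((shiftPoint x y p).2 j) ∈ T ↔ j ∈ T) ∧
      shiftPoint y x (shiftPoint x y p) = p ∧
      restrSign (swap x y * (shiftPoint x y p).2) T = -restrSign (swap x y * p.2) T := by
  obtain ⟨v, D⟩ := p
  simp only at hv hs
  have hD := mem_pointedCycles.1 hp
  obtain ⟨hDv, hc⟩ := isCycleOn_compl_singleton_iff.1 hD
  simp only at hDv hc hD
  have hxy : x ≠ y := fun e => hy (e ▸ hx)
  have hyv : y ≠ v := fun e => hy (e ▸ hv)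
  have hxv : x ≠ v := by
    intro e
    have := (hs v).2 hv
    rw [hDv, ← e, swap_apply_left] at this
    exact hy this
  have hne : D y ≠ y := fun e => hxy ((hc y hyv x hxv).eq_of_left e).symm
  -- If `D y = x`, then `Tᶜ \ {y}` is closed under `D` although it misses `x`.
  have hyx : D y ≠ x := by
    intro e
    obtain ⟨u, hu, huy⟩ := Finset.exists_mem_ne (s := Tᶜ) (by omega) y
    have hcl : ∀ w ∈ {w | w ∉ T ∧ w ≠ y}, D w ∈ {w | w ∉ T ∧ w ≠ y} := by
      rintro w ⟨hw, hwy⟩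
      have h1 : D w ≠ x := fun e' => hwy (D.injective (e'.trans e.symm))
      have h2 : D w ≠ y := fun e' => hw ((hs w).1 (by rwa [e', swap_apply_right]))
      refine ⟨fun h => hw ((hs w).1 ?_), h2⟩
      rwa [swap_apply_of_ne_of_ne h1 h2]
    have huT := Finset.mem_compl.1 hu
    exact (mem_of_sameCycle hcl (hc u (fun e' => huT (e' ▸ hv)) y hyv) ⟨huT, huy⟩).2 rfl
  have hb : D y ∉ T := by
    have := (hs y).not.2 hy
    rwa [swap_apply_of_ne_of_ne hyx hne] at this
  have hmem (j) : swap x v (swap y (D y) j) ∈ T ↔ j ∈ T := by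
    rw [swap_mem_iff (by simp [hx, hv]), swap_mem_iff (by simp [hy, hb])]
  refine ⟨mem_pointedCycles.2 (IsCycleOn.shift hD hxy hxv hyv hyx), hb, fun j => ?_, ?_, ?_⟩
  · exact (hs _).trans (hmem j)
  · have hbv : D y ≠ v := fun e => hb (e ▸ hv)
    have hE : (D * swap x v * swap y (D y)) x = v := by
      rw [mul_apply, swap_apply_of_ne_of_ne hxy hyx.symm, mul_apply, swap_apply_left, hDv]
    simp only [shiftPoint, hE, Prod.mk.injEq, true_and]
    rw [mul_assoc _ _ (swap y (D y)), swap_mul_self, mul_one, mul_assoc, swap_mul_self, mul_one]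
  · have h1 : restrSign (swap x y * (D * swap x v * swap y (D y))) T =
        restrSign ((swap x y * D) * swap x v) T := by
      refine restrSign_congr fun j hj => ?_
      have : swap y (D y) j = j :=
        swap_apply_of_ne_of_ne (fun e => hy (e ▸ hj)) (fun e => hb (e ▸ hj))
      simp [this]
    simp only [shiftPoint]
    rw [h1, restrSign_mul_of_right fun j hj => (swap_mem_iff (by simp [hx, hv]) j).2 hj,
      restrSign_swap hx hv hxv, mul_neg_one]

theorem perm_mem_iff_of_forall_mem {α : Type*} [Fintype α] {σ : Perm α} {T : Finset α}
    (h : ∀ j ∈ T, σ j ∈ T) (j : α) :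
    σ j ∈ T ↔ j ∈ T :=
  ⟨fun hj => mem_of_sameCycle (U := (T : Set α)) h
    (sameCycle_apply_left.2 (SameCycle.refl σ j)) hj, h j⟩

/-- The case in which `T` and its preimage under `π` differ by the exchange of `x` and `y`, with `π`
normalised to `swap x y`: the terms with the fixed point of `D` in `T` cancel against the others. -/
theorem sum_restrSign_swap_mul {T : Finset α} {x y : α} (hx : x ∈ T) (hy : y ∉ T)
    (hT : 2 ≤ #T) (hT' : 2 ≤ #Tᶜ) :
    ∑ p ∈ pointedCycles α, restrSign (swap x y * p.2) T = 0 := by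
  have hstable : ∑ p ∈ pointedCycles α with ∀ j, swap x y (p.2 j) ∈ T ↔ j ∈ T,
      restrSign (swap x y * p.2) T = ∑ p ∈ pointedCycles α, restrSign (swap x y * p.2) T := by
    refine sum_filter_of_ne fun p _ hne => ?_
    refine perm_mem_iff_of_forall_mem (σ := swap x y * p.2) fun j hj => ?_
    by_contra hn
    exact hne (restrSign_eq_zero hj hn)
  rw [← hstable, ← sum_filter_add_sum_filter_not _ (fun p => p.1 ∈ T), add_eq_zero_iff_eq_neg,
    ← sum_neg_distrib]
  have back (p) (hp : p ∈ pointedCycles α) (hs : ∀ j, swap x y (p.2 j) ∈ T ↔ j ∈ T)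
      (hv : p.1 ∉ T) := shiftPoint_spec (T := Tᶜ) (x := y) (y := x) (by simpa) (by simpa)
        (by simpa) hp (by simpa) (fun j => by simpa [swap_comm y x] using (hs j).not)
  refine sum_bij' (fun p _ => shiftPoint x y p) (fun p _ => shiftPoint y x p) ?_ ?_ ?_ ?_ ?_
  all_goals
    rintro p hp
    simp only [mem_filter] at hp
    obtain ⟨⟨hp, hs⟩, hv⟩ := hp
  · obtain ⟨h1, h2, h3, -⟩ := shiftPoint_spec hx hy hT' hp hv hs
    simp only [mem_filter]
    exact ⟨⟨h1, h3⟩, h2⟩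
  · obtain ⟨h1, h2, h3, -⟩ := back p hp hs hv
    simp only [mem_filter]
    exact ⟨⟨h1, fun j => by simpa [swap_comm y x, not_iff_not] using h3 j⟩, by simpa using h2⟩
  · exact (shiftPoint_spec hx hy hT' hp hv hs).2.2.2.1
  · exact (back p hp hs hv).2.2.2.1
  · rw [(shiftPoint_spec hx hy hT' hp hv hs).2.2.2.2, neg_neg]

/-- Conjugating `D` by `swap z w` does not change its values on `T` except for a transposition of
`π z` and `π w` after applying `π`, which reverses the sign. -/
theorem sum_restrSign_of_nontrivial_diff {π : Perm α} {T : Finset α} {z w : α} (hzw : z ≠ w)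
    (hz : z ∉ T) (hw : w ∉ T) (hπz : π z ∈ T) (hπw : π w ∈ T) :
    ∑ p ∈ pointedCycles α, restrSign (π * p.2) T = 0 := by
  have h := sum_pointedCycles_conj (swap z w) fun D => restrSign (π * D) T
  have flip (D : Perm α) :
      restrSign (π * (swap z w * D * (swap z w)⁻¹)) T = -restrSign (π * D) T := by
    have h1 : restrSign (π * (swap z w * D * (swap z w)⁻¹)) T =
        restrSign (swap (π z) (π w) * (π * D)) T := by
      refine restrSign_congr fun j hj => ?_
      have : swap z w j = j :=
        swap_apply_of_ne_of_ne (fun e => hz (e ▸ hj)) (fun e => hw (e ▸ hj))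
      simp [this, Equiv.swap_apply_apply]
    rw [h1, restrSign_mul_of_left (swap_mem_iff (by simp [hπz, hπw])),
      restrSign_swap hπz hπw (π.injective.ne hzw), neg_one_mul]
  simp only [flip, sum_neg_distrib] at h
  omega

/-- The group algebra element `∑ D` over the pointed cycles acts as zero on the middle exterior
powers of the permutation representation; this is the vanishing of its matrix entries. -/
theorem sum_restrSign_pointedCycles (π : Perm α) {T : Finset α} (hT : 2 ≤ #T) (hT' : 2 ≤ #Tᶜ) :
    ∑ p ∈ pointedCycles α, restrSign (π * p.2) T = 0 := by
  set J : Finset α := T.map π.symm.toEmbedding with hJ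
  have memJ (j) : j ∈ J ↔ π j ∈ T := by simp [hJ]
  have hcard : #(J \ T) = #(T \ J) := by
    have h1 : #J = #T := by simp [hJ]
    have h2 := card_sdiff_add_card_inter J T
    have h3 := card_sdiff_add_card_inter T J
    rw [inter_comm] at h3
    omega
  rcases lt_trichotomy #(J \ T) 1 with h | h | h
  · -- `D` would have to preserve `T`, which contains neither all nor none of its moved points
    have hsub : T ⊆ J := by
      rw [← sdiff_eq_empty_iff_subset, ← card_eq_zero]; omega
    have hsub' : J ⊆ T := by
      rw [← sdiff_eq_empty_iff_subset, ← card_eq_zero]; omega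
    refine sum_eq_zero fun p hp => ?_
    obtain ⟨-, hc⟩ := isCycleOn_compl_singleton_iff.1 (mem_pointedCycles.1 hp)
    by_cases hst : ∀ j ∈ (T : Set α), p.2 j ∈ (T : Set α)
    · obtain ⟨a, ha, hav⟩ := Finset.exists_mem_ne (s := T) (by omega) p.1
      obtain ⟨b, hb, hbv⟩ := Finset.exists_mem_ne (s := Tᶜ) (by omega) p.1
      exact absurd (mem_of_sameCycle hst (hc a hav b hbv) ha) (by simpa using hb)
    · push Not at hst
      obtain ⟨j, hj, hn⟩ := hst
      refine restrSign_eq_zero hj fun hm => hn (hsub' ((memJ _).2 hm))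
  · obtain ⟨y, hy⟩ := card_eq_one.1 h
    obtain ⟨x, hx⟩ := card_eq_one.1 (hcard ▸ h)
    have hy' : y ∈ J \ T := by simp [hy]
    have hx' : x ∈ T \ J := by simp [hx]
    simp only [mem_sdiff, memJ] at hx' hy'
    have hρ (j) (hj : j ∈ T) : (π * swap x y) j ∈ T := by
      rw [mul_apply, swap_apply_def]
      split_ifs with h1 h2
      · exact hy'.1
      · exact absurd (h2 ▸ hj) hy'.2
      · by_contra hn
        have : j ∈ T \ J := by simp [hj, memJ, hn]
        exact h1 (by simpa [hx] using this)
    have hmul (p : α × Perm α) : restrSign (π * p.2) T =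
        restrSign (π * swap x y) T * restrSign (swap x y * p.2) T := by
      rw [← restrSign_mul_of_left (perm_mem_iff_of_forall_mem hρ)]
      simp [mul_assoc]
    rw [sum_congr rfl fun p _ => hmul p, ← mul_sum,
      sum_restrSign_swap_mul hx'.1 hy'.2 hT hT', mul_zero]
  · obtain ⟨z, hz, w, hw, hzw⟩ := Finset.one_lt_card.1 h
    simp only [mem_sdiff, memJ] at hz hw
    exact sum_restrSign_of_nontrivial_diff hzw hz.2 hw.2 hz.1 hw.1

theorem eq_or_eq_of_card_eq_two (h2 : Fintype.card α = 2) {a b : α} (hab : a ≠ b) (c : α) :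
    c = a ∨ c = b := by
  have : ({a, b} : Finset α) = univ := eq_univ_of_card _ (by rw [card_pair hab, h2])
  have hc := mem_univ c
  rw [← this] at hc
  simpa using hc

theorem eq_one_of_mem_pointedCycles (h2 : Fintype.card α = 2) {p : α × Perm α}
    (hp : p ∈ pointedCycles α) : p.2 = 1 := by
  obtain ⟨hv, -⟩ := isCycleOn_compl_singleton_iff.1 (mem_pointedCycles.1 hp)
  ext z
  by_cases hz : z = p.1
  · simp [hz, hv]
  · have hDz : p.2 z ≠ p.1 := fun e => hz (p.2.injective (e.trans hv.symm))
    exact (eq_or_eq_of_card_eq_two h2 hz (p.2 z)).resolve_right hDz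

open Classical in
/-- For an odd permutation `π` of `n` points, `π * D` is a full cycle for `2 / n` of all pointed
cycles `D`. -/
theorem card_mul_card_isCycleOn (h2 : 2 ≤ Fintype.card α) {π : Perm α} (hπ : sign π = -1) :
    Fintype.card α * #{p ∈ pointedCycles α | (π * p.2).IsCycleOn Set.univ} =
      2 * #(pointedCycles α) := by
  rcases h2.eq_or_lt with h2 | h3
  · -- on two points, `D = 1` and `π` is the transposition
    have hall (p) (hp : p ∈ pointedCycles α) : (π * p.2).IsCycleOn Set.univ := by
      obtain ⟨c, hc⟩ : ∃ c, π c ≠ c := by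
        by_contra! hc
        have : π = 1 := Equiv.ext hc
        simp [this] at hπ
      have hall (z) : π.SameCycle c z := by
        rcases eq_or_eq_of_card_eq_two h2.symm hc z with rfl | rfl
        · exact sameCycle_apply_right.2 (SameCycle.refl _ _)
        · exact SameCycle.refl _ _
      rw [eq_one_of_mem_pointedCycles h2.symm hp, mul_one, isCycleOn_univ_iff]
      exact fun y z => (hall y).symm.trans (hall z)
    rw [filter_true_of_mem hall, ← h2]
  obtain ⟨x⟩ : Nonempty α := Fintype.card_pos_iff.1 (by omega)
  obtain ⟨q, hq⟩ : ∃ q : ℕ, ∀ a b, #{p ∈ pointedCycles α | p.2 a = b} = q := by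
    refine ⟨#{p ∈ pointedCycles α | p.2 x = x}, fun a b => ?_⟩
    refine Nat.eq_of_mul_eq_mul_left (show 0 < Fintype.card α by omega) ?_
    rw [card_mul_card_pointedCycles h3, card_mul_card_pointedCycles h3]
  have hP := card_mul_card_pointedCycles h3 x x
  rw [hq] at hP
  -- the contribution of a set `T` of `k` points avoiding `x`
  let f : ℕ → ℤ := fun k => if k = 0 then #(pointedCycles α) else if k = 1 then -q else
    if k + 1 = Fintype.card α then q else 0
  have hf (T) (hT : T ∈ ({x}ᶜ : Finset α).powerset) :
      ∑ p ∈ pointedCycles α, (-1) ^ #T * restrSign (π * p.2) T = f #T := by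
    have hTx := mem_powerset.1 hT
    have hcx : #({x}ᶜ : Finset α) + 1 = Fintype.card α := by
      rw [card_compl, card_singleton]; omega
    have hle := card_le_card hTx
    simp only [f]
    split_ifs with h0 h1 hn
    · simp [card_eq_zero.1 h0, restrSign_empty]
    · obtain ⟨a, rfl⟩ := card_eq_one.1 h1
      have (p : α × Perm α) : π (p.2 a) = a ↔ p.2 a = π.symm a := by
        rw [Equiv.eq_symm_apply]
      rw [← hq a (π.symm a), card_filter, Nat.cast_sum, ← sum_neg_distrib]
      refine sum_congr rfl fun p _ => ?_
      simp only [restrSign_singleton, mul_apply, this]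
      split_ifs <;> simp
    · obtain rfl : T = {x}ᶜ := eq_of_subset_of_card_le hTx (by omega)
      have (p : α × Perm α) : π (p.2 x) = x ↔ p.2 x = π.symm x := by
        rw [Equiv.eq_symm_apply]
      rw [← hq x (π.symm x), card_filter, Nat.cast_sum]
      refine sum_congr rfl fun p hp => ?_
      rw [restrSign_compl_singleton, mul_apply, Perm.sign_mul, hπ, Units.val_mul,
        sign_of_mem_pointedCycles h3 hp, ← hcx, pow_succ]
      simp only [this]
      split_ifs <;> simp [← mul_pow]
    · rw [← mul_sum, sum_restrSign_pointedCycles π (by omega) (by rw [card_compl]; omega),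
        mul_zero]
  have key : (#{p ∈ pointedCycles α | (π * p.2).IsCycleOn Set.univ} : ℤ) = 2 * q := by
    rw [card_filter, Nat.cast_sum]
    have (p : α × Perm α) := sum_restrSign_eq (π * p.2) x
    simp only [Nat.cast_ite, Nat.cast_one, Nat.cast_zero]
    simp_rw [← this]
    rw [sum_comm, sum_congr rfl hf, sum_powerset_apply_card]
    obtain ⟨m, hm⟩ : ∃ m, Fintype.card α = m + 3 := ⟨Fintype.card α - 3, by omega⟩
    rw [card_compl, card_singleton, hm, show m + 3 - 1 = m + 2 by omega, sum_range_succ,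
      sum_range_succ', sum_range_succ']
    rw [sum_eq_zero]
    · simp [f, hm, ← hP]
      ring
    · intro k hk
      have := mem_range.1 hk
      have h1 : k ≠ m := by omega
      simp [f, hm, h1]
  have key' : #{p ∈ pointedCycles α | (π * p.2).IsCycleOn Set.univ} = 2 * q := by exact_mod_cast key
  rw [key', ← hP]
  ring

theorem isConj_of_mem_pointedCycles (h2 : 2 ≤ Fintype.card α) {p q : α × Perm α}
    (hp : p ∈ pointedCycles α) (hq : q ∈ pointedCycles α) : IsConj p.2 q.2 := by
  rcases h2.eq_or_lt with h2 | h3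
  · rw [eq_one_of_mem_pointedCycles h2.symm hp, eq_one_of_mem_pointedCycles h2.symm hq]
  · obtain ⟨hc, hs⟩ := isCycle_of_mem_pointedCycles h3 hp
    obtain ⟨hc', hs'⟩ := isCycle_of_mem_pointedCycles h3 hq
    exact hc.isConj hc' (by omega)

open Classical in
/-- For a conjugation invariant set `C` of odd permutations of `n` points and one fixed pointed
cycle `D`, the product `π * D` is a full cycle for `2 / n` of all `π` in `C`. -/
theorem card_mul_card_mul_isCycleOn (h2 : 2 ≤ Fintype.card α) {C : Perm α → Prop}
    (hC : ∀ g π, C (g * π * g⁻¹) ↔ C π) (hodd : ∀ π, C π → sign π = -1)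
    {p : α × Perm α} (hp : p ∈ pointedCycles α) :
    Fintype.card α * #{π : Perm α | C π ∧ (π * p.2).IsCycleOn Set.univ} =
      2 * #{π : Perm α | C π} := by
  have indep (q) (hq : q ∈ pointedCycles α) :
      #{π : Perm α | C π ∧ (π * q.2).IsCycleOn Set.univ} =
        #{π : Perm α | C π ∧ (π * p.2).IsCycleOn Set.univ} := by
    obtain ⟨g, hg⟩ := isConj_iff.1 (isConj_of_mem_pointedCycles h2 hp hq)
    refine (Finset.card_equiv (MulAut.conj g).toEquiv fun π => ?_).symm
    have : (g * π * g⁻¹) * q.2 = g * (π * p.2) * g⁻¹ := by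
      rw [← hg]; group
    have hl : (g * (π * p.2) * g⁻¹).IsCycleOn Set.univ ↔ (π * p.2).IsCycleOn Set.univ := by
      simp only [isCycleOn_univ_iff, sameCycle_conj]
      exact ⟨fun h x y => by simpa using h (g x) (g y), fun h x y => h _ _⟩
    simp only [mem_filter, mem_univ, true_and]
    change _ ↔ C (g * π * g⁻¹) ∧ ((g * π * g⁻¹) * q.2).IsCycleOn Set.univ
    rw [this, hC, hl]
  have hpos : 0 < #(pointedCycles α) := card_pos.2 ⟨p, hp⟩
  refine Nat.eq_of_mul_eq_mul_left hpos ?_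
  have dc : ∑ q ∈ pointedCycles α, #{π : Perm α | C π ∧ (π * q.2).IsCycleOn Set.univ} =
      ∑ π : Perm α with C π, #{q ∈ pointedCycles α | (π * q.2).IsCycleOn Set.univ} := by
    simp_rw [← filter_filter, card_filter]
    exact sum_comm
  rw [sum_congr rfl indep, sum_const, smul_eq_mul] at dc
  have hr : ∑ π : Perm α with C π,
      Fintype.card α * #{q ∈ pointedCycles α | (π * q.2).IsCycleOn Set.univ} =
        ∑ π : Perm α with C π, 2 * #(pointedCycles α) :=
    sum_congr rfl fun π hπ => card_mul_card_isCycleOn h2 (hodd π (mem_filter.1 hπ).2)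
  rw [← mul_sum, ← dc, sum_const, smul_eq_mul] at hr
  rw [mul_left_comm, hr]
  ring

end Cancellation

/-! ### Cycle lengths and the partition of a permutation -/

section CycleLengths

variable {α : Type*} [Fintype α] [DecidableEq α]

/-- The length of the cycle of `σ` through `x`, which is `1` for a fixed point. -/
def cycleLength (σ : Perm α) (x : α) : ℕ := #{y | σ.SameCycle x y}

theorem cycleLength_pos (σ : Perm α) (x : α) : 0 < cycleLength σ x :=
  card_pos.2 ⟨x, by simp [SameCycle.refl]⟩

theorem cycleLength_congr {σ : Perm α} {x y : α} (h : σ.SameCycle x y) :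
    cycleLength σ x = cycleLength σ y := by
  rw [cycleLength, cycleLength]
  congr 1
  ext z
  simp only [mem_filter, mem_univ, true_and]
  exact ⟨h.symm.trans, h.trans⟩

theorem cycleLength_of_fixed {σ : Perm α} {x : α} (h : σ x = x) : cycleLength σ x = 1 := by
  rw [cycleLength, card_eq_one]
  refine ⟨x, ?_⟩
  ext y
  simp only [mem_filter, mem_univ, true_and, mem_singleton]
  exact ⟨fun hy => (hy.eq_of_left h).symm, fun e => e ▸ SameCycle.refl _ _⟩

theorem cycleLength_eq_card_support {σ : Perm α} {x : α} (h : σ x ≠ x) :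
    cycleLength σ x = #(σ.cycleOf x).support := by
  rw [cycleLength]
  congr 1
  ext y
  rw [mem_filter, mem_support_cycleOf_iff]
  simp [h]

theorem two_le_cycleLength {σ : Perm α} {x : α} (h : σ x ≠ x) : 2 ≤ cycleLength σ x := by
  rw [cycleLength_eq_card_support h]
  exact two_le_card_support_cycleOf_iff.2 h

/-- The `count k` cycles of length `k` together contain `k * count k` points. -/
theorem mul_count_parts_partition (σ : Perm α) (k : ℕ) :
    k * σ.partition.parts.count k = #{x | cycleLength σ x = k} := by
  rw [parts_partition, Multiset.count_add, Multiset.count_replicate]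
  rcases lt_trichotomy k 1 with h | rfl | h
  · obtain rfl : k = 0 := by omega
    symm
    rw [zero_mul, card_eq_zero, filter_eq_empty_iff]
    exact fun x _ => (cycleLength_pos σ x).ne'
  · have h0 : σ.cycleType.count 1 = 0 :=
      Multiset.count_eq_zero.2 fun h => absurd (one_lt_of_mem_cycleType h) (lt_irrefl 1)
    rw [h0, zero_add, if_pos rfl, one_mul, ← card_compl]
    congr 1
    ext x
    by_cases hx : σ x = x
    · simp [hx, cycleLength_of_fixed hx]
    · have := two_le_cycleLength hx
      simp only [mem_compl, mem_support, ne_eq, hx, mem_filter, mem_univ, true_and,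
        not_true_eq_false, not_false_eq_true, false_iff]
      omega
  · rw [if_neg (by omega), add_zero, cycleType_def, Multiset.count_map,
      ← Finset.filter_val, Finset.card_val]
    rw [Finset.card_eq_sum_card_fiberwise (f := fun x => σ.cycleOf x)
      (t := {c ∈ σ.cycleFactorsFinset | k = (Finset.card ∘ support) c})]
    · rw [sum_congr rfl (g := fun _ => k), sum_const, smul_eq_mul, mul_comm]
      intro c hc
      obtain ⟨hc, hk⟩ := mem_filter.1 hc
      rw [hk]
      refine congrArg Finset.card ?_
      ext x
      simp only [mem_filter, mem_univ, true_and]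
      constructor
      · rintro ⟨h1, rfl⟩
        rw [mem_support_cycleOf_iff]
        refine ⟨SameCycle.refl _ _, mem_support.2 fun h2 => ?_⟩
        rw [cycleLength_of_fixed h2] at h1
        simp only [Function.comp_apply] at hk h1
        omega
      · intro hx
        have e := cycle_is_cycleOf hx hc
        have hs : σ x ≠ x := mem_support.1 (mem_cycleFactorsFinset_support_le hc hx)
        exact ⟨by rw [cycleLength_eq_card_support hs, ← e]; rfl, e.symm⟩
    · intro x hx
      have hx : cycleLength σ x = k := by simpa using hx
      have hs : σ x ≠ x := fun h2 => by
        rw [cycleLength_of_fixed h2] at hx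
        omega
      simp [cycleOf_mem_cycleFactorsFinset_iff, hs, ← hx, cycleLength_eq_card_support hs]

theorem sign_eq_of_partition (σ : Perm α) :
    sign σ = (-1) ^ (Fintype.card α + Multiset.card σ.partition.parts) := by
  rw [sign_of_cycleType, parts_partition, Multiset.card_add, Multiset.card_replicate,
    sum_cycleType]
  have : #σ.support ≤ Fintype.card α := card_le_univ _
  obtain ⟨m, hm⟩ := Nat.exists_eq_add_of_le this
  rw [hm, Nat.add_sub_cancel_left,
    show #σ.support + m + (Multiset.card σ.cycleType + m) =
      #σ.support + Multiset.card σ.cycleType + 2 * m by ring, pow_add _ _ (2 * m), pow_mul]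
  simp

end CycleLengths

/-! ### Inserting a point into a cycle -/

section PointInsertion

variable {N : ℕ}

/-- The permutation `decomposeFin.symm (p.succ, β)` arises from `β` by inserting the new point `0`
right before `p` into its cycle. Identifying `0` with `p` hence maps its cycles to those of `β`. -/
theorem sameCycle_decomposeFin_symm_iff {p : Fin N} {β : Perm (Fin N)} {x y : Fin (N + 1)} :
    (decomposeFin.symm (p.succ, β)).SameCycle x y ↔
      β.SameCycle (Fin.cases (motive := fun _ => Fin N) p id x)
        (Fin.cases (motive := fun _ => Fin N) p id y) := by
  set π := decomposeFin.symm (p.succ, β) with hπ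
  let f : Fin (N + 1) → Fin N := fun x => Fin.cases p id x
  have h0 : π 0 = p.succ := decomposeFin_symm_apply_zero _ _
  have hs (u : Fin N) : π u.succ = if β u = p then 0 else (β u).succ := by
    rw [hπ, decomposeFin_symm_apply_succ, swap_apply_def]
    simp [Fin.succ_ne_zero]
  change _ ↔ β.SameCycle (f x) (f y)
  have step (y) : β.SameCycle (f y) (f (π y)) := by
    refine Fin.cases ?_ (fun u => ?_) y
    · rw [h0]; exact SameCycle.refl _ _
    · have : f (π u.succ) = β u := by
        rw [hs]
        split_ifs with h
        · exact h.symm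
        · rfl
      rw [this]
      exact sameCycle_apply_right.2 (SameCycle.refl _ _)
  have lift {u w : Fin N} (h : β.SameCycle u w) : π.SameCycle u.succ w.succ := by
    refine mem_of_sameCycle (U := {w : Fin N | π.SameCycle u.succ w.succ}) (fun w hw => ?_) h
      (SameCycle.refl π u.succ)
    have hw := sameCycle_apply_right.2 (Set.mem_ofPred.1 hw)
    rw [hs] at hw
    split_ifs at hw with h
    · have := sameCycle_apply_right.2 hw
      rw [h0] at this
      rwa [Set.mem_ofPred, h]
    · exact hw
  have proj (x) : π.SameCycle x (f x).succ := by
    refine Fin.cases ?_ (fun u => SameCycle.refl _ _) x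
    change π.SameCycle 0 p.succ
    rw [← h0]
    exact sameCycle_apply_right.2 (SameCycle.refl _ _)
  refine ⟨fun h => ?_, fun h => (proj x).trans ((lift h).trans (proj y).symm)⟩
  exact mem_of_sameCycle (U := {y | β.SameCycle (f x) (f y)})
    (fun y hy => SameCycle.trans hy (step y)) h (SameCycle.refl _ _)

theorem isCycleOn_decomposeFin_symm_succ {p : Fin N} {β : Perm (Fin N)} :
    (decomposeFin.symm (p.succ, β)).IsCycleOn Set.univ ↔ β.IsCycleOn Set.univ := by
  simp only [isCycleOn_univ_iff, sameCycle_decomposeFin_symm_iff]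
  exact ⟨fun h x y => h x.succ y.succ, fun h x y => h _ _⟩

theorem not_isCycleOn_decomposeFin_symm_zero (hN : N ≠ 0) {β : Perm (Fin N)} :
    ¬ (decomposeFin.symm (0, β)).IsCycleOn Set.univ := by
  rw [isCycleOn_univ_iff]
  intro h
  have := (h 0 (Fin.succ ⟨0, Nat.pos_of_ne_zero hN⟩)).eq_of_left (decomposeFin_symm_apply_zero _ _)
  exact (Fin.succ_ne_zero _ this.symm).elim

/-- Adding a fixed point to a full cycle gives a pointed cycle. -/
theorem mk_zero_decomposeFin_symm_mem_pointedCycles {β : Perm (Fin N)}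
    (h : β.IsCycleOn Set.univ) : (0, decomposeFin.symm (0, β)) ∈ pointedCycles (Fin (N + 1)) := by
  rw [mem_pointedCycles, isCycleOn_compl_singleton_iff]
  refine ⟨decomposeFin_symm_apply_zero _ _, fun x hx y hy => ?_⟩
  obtain ⟨u, rfl⟩ := Fin.exists_succ_eq.2 hx
  obtain ⟨w, rfl⟩ := Fin.exists_succ_eq.2 hy
  refine mem_of_sameCycle (σ := β) (U := {w : Fin N | SameCycle _ u.succ w.succ}) (fun w hw => ?_)
    (isCycleOn_univ_iff.1 h u w) (SameCycle.refl _ _)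
  have := sameCycle_apply_right.2 (Set.mem_ofPred.1 hw)
  simpa using this

theorem decomposeFin_symm_mul (p : Fin (N + 1)) (β γ : Perm (Fin N)) :
    decomposeFin.symm (p, β) * decomposeFin.symm (0, γ) = decomposeFin.symm (p, β * γ) := by
  ext x
  refine Fin.cases ?_ (fun u => ?_) x <;> simp

/-- Inserting a point before `p` lengthens the cycle of `p` by one and keeps all others; stated
without `Multiset.erase`. -/
theorem cons_parts_partition_decomposeFin_symm (p : Fin N) (β : Perm (Fin N)) :
    cycleLength β p ::ₘ (decomposeFin.symm (p.succ, β)).partition.parts =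
      (cycleLength β p + 1) ::ₘ β.partition.parts := by
  set π := decomposeFin.symm (p.succ, β) with hπ
  set i := cycleLength β p with hi
  have hlen0 : cycleLength π 0 = i + 1 := by
    rw [cycleLength, Fin.card_filter_univ_succ, if_pos (SameCycle.refl _ _), hi, cycleLength]
    simp [hπ, sameCycle_decomposeFin_symm_iff]
  have hlen (u : Fin N) :
      cycleLength π u.succ = cycleLength β u + if β.SameCycle p u then 1 else 0 := by
    rw [cycleLength, Fin.card_filter_univ_succ, cycleLength]
    simp only [hπ, sameCycle_decomposeFin_symm_iff, sameCycle_comm (x := p)]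
    change (if β.SameCycle u p then _ else _) = _
    split_ifs <;> rfl
  ext k
  rw [Multiset.count_cons, Multiset.count_cons]
  rcases Nat.eq_zero_or_pos k with rfl | hk
  · have h1 : 0 ∉ π.partition.parts := fun h => absurd (π.partition.parts_pos h) (lt_irrefl 0)
    have h2 : 0 ∉ β.partition.parts := fun h => absurd (β.partition.parts_pos h) (lt_irrefl 0)
    have h3 := cycleLength_pos β p
    rw [Multiset.count_eq_zero.2 h1, Multiset.count_eq_zero.2 h2, if_neg (by omega),
      if_neg (by omega)]
  -- only the `i` points in the cycle of `p` change their cycle length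
  have key : #{u : Fin N | cycleLength π u.succ = k} + (if k = i then i else 0) =
      #{u | cycleLength β u = k} + if k = i + 1 then i else 0 := by
    have hsum (c : Prop) [Decidable c] : (if c then i else 0) =
        ∑ u, if β.SameCycle p u ∧ c then 1 else 0 := by
      split_ifs with h <;> simp [h, hi, cycleLength]
    rw [hsum, hsum, card_filter, card_filter, ← sum_add_distrib, ← sum_add_distrib]
    refine sum_congr rfl fun u _ => ?_
    rw [hlen]
    by_cases hu : β.SameCycle p u
    · rw [hi, cycleLength_congr hu]
      simp [hu]
      grind
    · simp [hu]
  have hπk := mul_count_parts_partition π k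
  have hβk := mul_count_parts_partition β k
  rw [Fin.card_filter_univ_succ, hlen0] at hπk
  refine Nat.eq_of_mul_eq_mul_left hk ?_
  rw [mul_add, mul_add, hπk, hβk]
  split_ifs at * <;> grind

/-- Inserting a point before `p` produces the type `mu` exactly if `mu` has a part one longer than
the cycle of `p`, and the original type is `mu` with this part shortened. -/
theorem hasType_decomposeFin_symm_iff {mu : (N + 1).Partition} {p : Fin N} {β : Perm (Fin N)} :
    HasType (decomposeFin.symm (p.succ, β)) mu ↔
      ∃ h : 0 < cycleLength β p ∧ cycleLength β p + 1 ∈ mu.parts,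
        HasType β (down mu (cycleLength β p) h) := by
  have hc := cons_parts_partition_decomposeFin_symm p β
  set i := cycleLength β p with hi
  unfold HasType down
  constructor
  · intro h
    rw [h] at hc
    have hm : i + 1 ∈ mu.parts := by
      have : i + 1 ∈ i ::ₘ mu.parts := hc ▸ Multiset.mem_cons_self _ _
      simpa using this
    refine ⟨⟨cycleLength_pos β p, hm⟩, ?_⟩
    rw [← Multiset.cons_erase hm, Multiset.cons_swap, Multiset.cons_inj_right] at hc
    exact hc.symm
  · rintro ⟨⟨hpos, hm⟩, h⟩
    rw [h, Multiset.cons_swap, Multiset.cons_erase hm, Multiset.cons_inj_right] at hc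
    exact hc

theorem isCycleOn_finRotate (N : ℕ) : (finRotate N).IsCycleOn Set.univ := by
  rcases lt_or_ge N 2 with h | h
  · have : Subsingleton (Fin N) := Fin.subsingleton_iff_le_one.2 (by omega)
    exact isCycleOn_of_subsingleton _ _
  · have := (isCycle_finRotate_of_le h).isCycleOn
    have hs := support_finRotate_of_le h
    convert this
    ext x
    have := hs ▸ mem_univ x
    simpa using this

theorem isLongCycle_finRotate_mul_inv {β : Perm (Fin N)} :
    IsLongCycle (finRotate N * β⁻¹) ↔ (β * (finRotate N)⁻¹).IsCycleOn Set.univ := by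
  rw [IsLongCycle, ← isCycleOn_inv, mul_inv_rev, inv_inv]

open Classical in
theorem card_hasType_and_isCycleOn (hN : N ≠ 0) (mu : (N + 1).Partition) :
    #{π : Perm (Fin (N + 1)) | HasType π mu ∧
      (π * decomposeFin.symm (0, (finRotate N)⁻¹)).IsCycleOn Set.univ} =
    ∑ i ∈ Finset.range (N + 1), if h : 0 < i ∧ i + 1 ∈ mu.parts then
      i * mult (down mu i h) i * numB (down mu i h) else 0 := by
  have lhs : #{π : Perm (Fin (N + 1)) | HasType π mu ∧
      (π * decomposeFin.symm (0, (finRotate N)⁻¹)).IsCycleOn Set.univ} =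
      ∑ p : Fin N, ∑ β : Perm (Fin N), if HasType (decomposeFin.symm (p.succ, β)) mu ∧
        (β * (finRotate N)⁻¹).IsCycleOn Set.univ then 1 else 0 := by
    rw [card_filter, ← Equiv.sum_comp decomposeFin.symm, Fintype.sum_prod_type, Fin.sum_univ_succ]
    simp only [decomposeFin_symm_mul, not_isCycleOn_decomposeFin_symm_zero hN, and_false, if_false,
      sum_const_zero, zero_add, isCycleOn_decomposeFin_symm_succ]
  have rhs (i : ℕ) (h : 0 < i ∧ i + 1 ∈ mu.parts) :
      i * mult (down mu i h) i * numB (down mu i h) =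
        ∑ p : Fin N, ∑ β : Perm (Fin N), if cycleLength β p = i ∧ HasType β (down mu i h) ∧
          (β * (finRotate N)⁻¹).IsCycleOn Set.univ then 1 else 0 := by
    rw [numB, Nat.card_eq_fintype_card, Fintype.card_subtype, card_filter, mul_sum, sum_comm]
    refine sum_congr rfl fun β _ => ?_
    rw [isLongCycle_finRotate_mul_inv]
    split_ifs with hb
    · rw [mult, ← hb.1, mul_count_parts_partition, card_filter, mul_one]
      simp [hb.1, hb.2]
    · rw [mul_zero, eq_comm]
      refine sum_eq_zero fun p _ => ?_
      rw [if_neg fun h => hb h.2]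
  have cl_lt (β : Perm (Fin N)) (p : Fin N) : cycleLength β p ∈ Finset.range (N + 1) := by
    have := card_le_univ ({y | β.SameCycle p y} : Finset (Fin N))
    rw [Fintype.card_fin] at this
    exact mem_range.2 (Nat.lt_succ_of_le this)
  rw [lhs]
  simp_rw [rhs]
  have hd (i : ℕ) : (if h : 0 < i ∧ i + 1 ∈ mu.parts then
      ∑ p : Fin N, ∑ β : Perm (Fin N), if cycleLength β p = i ∧ HasType β (down mu i h) ∧
          (β * (finRotate N)⁻¹).IsCycleOn Set.univ then 1 else 0 else 0) =
      ∑ p : Fin N, ∑ β : Perm (Fin N), if cycleLength β p = i ∧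
        (∃ h : 0 < i ∧ i + 1 ∈ mu.parts, HasType β (down mu i h)) ∧
          (β * (finRotate N)⁻¹).IsCycleOn Set.univ then 1 else 0 := by
    split_ifs with h <;> simp [h]
  simp_rw [hd]
  rw [eq_comm, sum_comm]
  refine sum_congr rfl fun p _ => ?_
  rw [sum_comm]
  refine sum_congr rfl fun β _ => ?_
  rw [hasType_decomposeFin_symm_iff, sum_eq_single_of_mem _ (cl_lt β p)]
  · simp
  · intro i _ hi
    rw [if_neg fun h => hi h.1.symm]

end PointInsertion

/-! ### The size of the set of permutations of a given type -/

section TypeClasses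

variable {n : ℕ}

/-- Mathlib's `cycleType` omits fixed points, so the parts equal to `1` have to be split off. -/
theorem filter_parts_add_replicate (mu : n.Partition) :
    mu.parts.filter (2 ≤ ·) + Multiset.replicate (mu.parts.count 1) 1 = mu.parts := by
  conv_rhs => rw [← Multiset.filter_add_not (2 ≤ ·) mu.parts]
  rw [← Multiset.filter_eq]
  congr 1
  refine Multiset.filter_congr fun k hk => ?_
  have := mu.parts_pos hk
  omega

theorem sum_filter_parts_add_count (mu : n.Partition) :
    (mu.parts.filter (2 ≤ ·)).sum + mu.parts.count 1 = n := by
  have h := congrArg Multiset.sum (filter_parts_add_replicate mu)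
  rwa [Multiset.sum_add, Multiset.sum_replicate, smul_eq_mul, mul_one, mu.parts_sum] at h

theorem hasType_iff_cycleType {σ : Perm (Fin n)} {mu : n.Partition} :
    HasType σ mu ↔ σ.cycleType = mu.parts.filter (2 ≤ ·) := by
  rw [HasType]
  refine ⟨fun h => by rw [← h, filter_parts_partition_eq_cycleType], fun h => ?_⟩
  have hc : Fintype.card (Fin n) - #σ.support = mu.parts.count 1 := by
    have := sum_filter_parts_add_count mu
    rw [← h, sum_cycleType] at this
    rw [Fintype.card_fin]
    omega
  rw [parts_partition, hc, h, filter_parts_add_replicate]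

theorem hasType_conj {g σ : Perm (Fin n)} {mu : n.Partition} :
    HasType (g * σ * g⁻¹) mu ↔ HasType σ mu := by
  rw [hasType_iff_cycleType, hasType_iff_cycleType, cycleType_conj]

theorem numA_eq_card (mu : n.Partition) [DecidablePred fun σ : Perm (Fin n) => HasType σ mu] :
    numA mu = #{σ : Perm (Fin n) | HasType σ mu} := by
  rw [numA, Nat.card_eq_fintype_card, Fintype.card_subtype]

theorem zee_eq (mu : n.Partition) :
    zee mu = (n - (mu.parts.filter (2 ≤ ·)).sum).factorial * (mu.parts.filter (2 ≤ ·)).prod *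
      ∏ i ∈ (mu.parts.filter (2 ≤ ·)).toFinset, ((mu.parts.filter (2 ≤ ·)).count i).factorial := by
  have h1 : n - (mu.parts.filter (2 ≤ ·)).sum = mu.parts.count 1 := by
    have := sum_filter_parts_add_count mu
    omega
  have h2 : mu.parts.toFinset ⊆ insert 1 (mu.parts.filter (2 ≤ ·)).toFinset := by
    intro k hk
    have hk := Multiset.mem_toFinset.1 hk
    have := mu.parts_pos hk
    rw [mem_insert, Multiset.mem_toFinset, Multiset.mem_filter]
    by_cases h : k = 1
    · exact Or.inl h
    · exact Or.inr ⟨hk, by omega⟩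
  rw [zee, prod_subset h2, prod_insert (by simp), h1, mul_assoc, mul_assoc,
    prod_multiset_count, ← prod_mul_distrib, one_pow, one_mul]
  · congr 1
    · refine prod_congr rfl fun k hk => ?_
      have hk := (Multiset.mem_filter.1 (Multiset.mem_toFinset.1 hk)).2
      rw [mult, Multiset.count_filter_of_pos hk]
  · intro k _ hk
    simp [mult, Multiset.count_eq_zero.2 (fun h => hk (Multiset.mem_toFinset.2 h))]

theorem numA_mul_zee (mu : n.Partition) : numA mu * zee mu = n.factorial := by
  classical
  have h := card_of_cycleType_mul_eq (Fin n) (mu.parts.filter (2 ≤ ·))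
  rw [Fintype.card_fin, if_pos ⟨by have := sum_filter_parts_add_count mu; omega, fun a ha =>
    (Multiset.mem_filter.1 ha).2⟩, ← zee_eq] at h
  rw [← h, numA_eq_card]
  simp only [hasType_iff_cycleType]

end TypeClasses

theorem sign_of_hasType {N : ℕ} {mu : (N + 1).Partition}
    (hp : Multiset.card mu.parts ≡ N [MOD 2]) {π : Perm (Fin (N + 1))} (h : HasType π mu) :
    sign π = -1 := by
  rw [sign_eq_of_partition, h, Fintype.card_fin, Odd.neg_one_pow]
  rw [Nat.odd_iff]
  have : Multiset.card mu.parts % 2 = N % 2 := hp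
  omega

/-- The integral form of the identity between the sum of the numbers `B` and `A`. -/
theorem mul_sum_eq_two_mul_numA {N : ℕ} {mu : (N + 1).Partition}
    (hp : Multiset.card mu.parts ≡ N [MOD 2]) :
    (N + 1) * ∑ i ∈ Finset.range (N + 1), (if h : 0 < i ∧ i + 1 ∈ mu.parts then
      i * mult (down mu i h) i * numB (down mu i h) else 0) = 2 * numA mu := by
  classical
  have hN : N ≠ 0 := by
    rintro rfl
    -- the only partition of `1` has one part, which is the wrong parity
    obtain rfl : mu = (default : Nat.Partition 1) := Subsingleton.elim (α := Nat.Partition 1) _ _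
    revert hp
    decide
  have key := card_mul_card_mul_isCycleOn (by rw [Fintype.card_fin]; omega)
    (fun g π => hasType_conj) (fun π => sign_of_hasType hp)
    (mk_zero_decomposeFin_symm_mem_pointedCycles (isCycleOn_inv.2 (isCycleOn_finRotate N)))
  rwa [Fintype.card_fin, card_hasType_and_isCycleOn hN, ← numA_eq_card] at key

end CycleFactor

theorem theorem2 (N : ℕ) (mu : (N + 1).Partition)
    (hp : Multiset.card mu.parts ≡ N [MOD 2]) :
    ((N : ℚ) + 1) / 2 *
        (∑ i ∈ Finset.range (N + 1),
          if h : 0 < i ∧ i + 1 ∈ mu.parts then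
            (i : ℚ) * (CycleFactor.mult (CycleFactor.down mu i h) i : ℚ) *
              (CycleFactor.numB (CycleFactor.down mu i h) : ℚ)
          else 0) = (CycleFactor.numA mu : ℚ) ∧
      (CycleFactor.numA mu : ℚ) =
        ((N + 1).factorial : ℚ) / (CycleFactor.zee mu : ℚ) := by
  constructor
  · have key := congrArg (Nat.cast : ℕ → ℚ) (CycleFactor.mul_sum_eq_two_mul_numA hp)
    push_cast [apply_dite (Nat.cast : ℕ → ℚ)] at key
    linarith
  · have h := CycleFactor.numA_mul_zee mu
    rw [eq_div_iff]
    · exact_mod_cast h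
    · intro h0
      rw [Nat.cast_eq_zero.1 h0, mul_zero] at h
      exact (Nat.factorial_ne_zero _) h.symm
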